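/- Let $k$ be a field and let $\mathcal T$ be a $k$-linear triangulated category of finite type over $k$ (that is, $\bigoplus_{i\in\mathbb Z}\mathrm{Hom}(E,F[i])$ is finite dimensional for all objects $E,F$), with a Serre functor $S$ and a classical generator $G$. Let $\sigma=(\mathcal P,Z)$ be a Bridgeland stability condition on $\mathcal T$. For an object $X$, let $\varphi^+_\sigma(X)$ be the maximal phase of the factors of its Harder--Narasimhan filtration ($-\infty$ if $X=0$). For an interval $I\subset\mathbb R$, let $\mathcal P(I)$ be the extension-closed subcategory generated by the $\mathcal P(\psi)$, $\psi\in I$. Assume: * $\sigma$ is Serre-invariant: $S\cdot\sigma=\sigma\cdot g$ for some $g\in\widetilde{GL}{}_2^+(\mathbb R)$. Explicitly, there are an orientation-preserving linear automorphism $T$ of $\mathbb R^2=\mathbb C$ and an increasing map $f:\mathbb R\to\mathbb R$ with $f(\psi+1)=f(\psi)+1$, inducing the same map on $\mathbb R/2\mathbb Z$, such that $S(\mathcal P(\psi))=\mathcal P(f(\psi))$ for all $\psi$, and $Z\circ S^{-1}=T^{-1}\circ Z$; * the upper Serre dimension $\overline{\mathrm{Sdim}}(\mathcal T):=\limsup_{m\to\infty}\frac1m\varphi_\sigma^+(S^mG)$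 is equal to a positive integer $n$. Then there is a real number $\varphi$ such that the full subcategory $\mathcal A_\varphi=\mathcal P([\varphi,\varphi+1))$, which is the heart of a bounded t-structure on $\mathcal T$, satisfies $S\mathcal A_\varphi[-n]=\mathcal A_\varphi$ (as strictly full subcategories). Moreover $\mathcal A_\varphi$ has homological dimension $n$, in the sense that $n$ is the largest integer $i$ such that $\mathrm{Hom}_{\mathcal T}(A,B[i])\neq 0$ for some $A,B\in\mathcal A_\varphi$. -/

import Mathlib

open CategoryTheory CategoryTheory.Limits CategoryTheory.Pretriangulated

universe w v u

noncomputable section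

namespace SerreStab

section Linear

variable (k : Type w) [Field k] (C : Type u) [Category.{v} C] [Preadditive C] [Linear k C]

/-- `C` is of finite type over `k`: for all objects `E`, `F`, the `k`-vector space
`⨁ i, Hom(E, F[i])` is finite dimensional. -/
def IsFiniteType [HasShift C ℤ] : Prop :=
  ∀ E F : C, Module.Finite k (DirectSum ℤ fun i => (E ⟶ F⟦i⟧))

/-- A Serre functor: an autoequivalence `S` of `C` together with `k`-linear isomorphisms
`Hom(X, Y) ≃ Hom(Y, S X)^*`, natural in `X` and in `Y`. (That such an `S` is `k`-linear and exact
is automatic.) -/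
structure SerreFunctor where
  /-- the underlying functor -/
  functor : C ⥤ C
  isEquivalence : functor.IsEquivalence
  /-- the duality isomorphism -/
  duality (X Y : C) : (X ⟶ Y) ≃ₗ[k] Module.Dual k (Y ⟶ functor.obj X)
  naturality_left {X X' Y : C} (a : X' ⟶ X) (f : X ⟶ Y) (g : Y ⟶ functor.obj X') :
    duality X' Y (a ≫ f) g = duality X Y f (g ≫ functor.map a)
  naturality_right {X Y Y' : C} (b : Y ⟶ Y') (f : X ⟶ Y) (g : Y' ⟶ functor.obj X) :
    duality X Y' (f ≫ b) g = duality X Y f (b ≫ g)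

end Linear

section Triangulated

variable (C : Type u) [Category.{v} C] [Preadditive C] [HasZeroObject C] [HasShift C ℤ]
  [∀ n : ℤ, (shiftFunctor C n).Additive] [Pretriangulated C]

/-- The relations `[X₂] = [X₁] + [X₃]` for the distinguished triangles `X₁ → X₂ → X₃ → X₁[1]`. -/
def grothendieckRelations : AddSubgroup (FreeAbelianGroup C) :=
  AddSubgroup.closure {x | ∃ T : Triangle C, T ∈ distTriang C ∧
    x = FreeAbelianGroup.of T.obj₂ - FreeAbelianGroup.of T.obj₁ - FreeAbelianGroup.of T.obj₃}

/-- The Grothendieck group `K₀(C)` of a triangulated category. -/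
abbrev K0 : Type u := FreeAbelianGroup C ⧸ grothendieckRelations C

variable {C}

/-- The class `[X]` of an object in `K₀(C)`. -/
def K0.cls (X : C) : K0 C := QuotientAddGroup.mk (FreeAbelianGroup.of X)

/-- `HasHNPhases P X L`: the object `X` has a finite filtration by distinguished triangles
`Eᵢ₋₁ → Eᵢ → Aᵢ → Eᵢ₋₁[1]`, `i = 1, …, m`, with `E₀ = 0`, `Eₘ = X` and with nonzero factors
`Aᵢ ∈ P (ψᵢ)`, `ψ₁ > ψ₂ > ⋯ > ψₘ` (a Harder-Narasimhan filtration); here `L` is the list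
`[ψₘ, …, ψ₁]` of the phases of the factors, beginning with the last one. -/
inductive HasHNPhases (P : ℝ → ObjectProperty C) : C → List ℝ → Prop
  | zero (X : C) (hX : IsZero X) : HasHNPhases P X []
  | step {E X A : C} (f : E ⟶ X) (g : X ⟶ A) (h : A ⟶ E⟦(1 : ℤ)⟧)
      (hT : Triangle.mk f g h ∈ distTriang C) (L : List ℝ) (hE : HasHNPhases P E L)
      (ψ : ℝ) (hA : P ψ A) (hA0 : ¬ IsZero A) (hψ : ∀ φ ∈ L, ψ < φ) :
      HasHNPhases P X (ψ :: L)

/-- The extension-closed subcategory `P(I)` generated by the objects of the `P φ`, `φ ∈ I`. -/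
inductive phaseInterval (P : ℝ → ObjectProperty C) (I : Set ℝ) : ObjectProperty C
  | zero (X : C) (hX : IsZero X) : phaseInterval P I X
  | of_mem (X : C) (φ : ℝ) (hφ : φ ∈ I) (hX : P φ X) : phaseInterval P I X
  | ext {X Y Z : C} (f : X ⟶ Y) (g : Y ⟶ Z) (h : Z ⟶ X⟦(1 : ℤ)⟧)
      (hT : Triangle.mk f g h ∈ distTriang C)
      (hX : phaseInterval P I X) (hZ : phaseInterval P I Z) : phaseInterval P I Y

/-- The homological dimension of a subcategory `A` of `C` (a heart): the largest integer `i` such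
that `Hom(X, Y[i]) ≠ 0` for some objects `X`, `Y` of `A`. -/
def HasHomologicalDimension (A : ObjectProperty C) (n : ℤ) : Prop :=
  IsGreatest {i : ℤ | ∃ X Y : C, A X ∧ A Y ∧ ∃ f : X ⟶ Y⟦i⟧, f ≠ 0} n

variable (C)

/-- A Bridgeland stability condition `(P, Z)` on a triangulated category: a slicing `P` and a
group homomorphism `Z : K₀(C) → ℂ` that are compatible. -/
structure StabilityCondition where
  /-- `P φ` is the full subcategory of semistable objects of phase `φ` (and zero objects) -/
  P : ℝ → ObjectProperty C
  /-- the central charge -/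
  Z : K0 C →+ ℂ
  of_iso (φ : ℝ) {X Y : C} (e : X ≅ Y) (hX : P φ X) : P φ Y
  of_isZero (φ : ℝ) {X : C} (hX : IsZero X) : P φ X
  biprod (φ : ℝ) {X Y : C} (hX : P φ X) (hY : P φ Y) : P φ (X ⊞ Y)
  shift_iff (φ : ℝ) (X : C) : P (φ + 1) (X⟦(1 : ℤ)⟧) ↔ P φ X
  hom_eq_zero {φ ψ : ℝ} (h : ψ < φ) {X Y : C} (hX : P φ X) (hY : P ψ Y) (f : X ⟶ Y) : f = 0
  exists_HN (X : C) : ∃ L, HasHNPhases P X L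
  charge (φ : ℝ) {X : C} (hX : P φ X) (hX0 : ¬ IsZero X) :
    ∃ m : ℝ, 0 < m ∧ Z (K0.cls X) = m * Complex.exp (Real.pi * φ * Complex.I)

end Triangulated

/-- An element `(T, f)` of the universal cover of `GL₂⁺(ℝ)`: an orientation preserving linear
automorphism `T` of `ℝ² = ℂ` and an increasing map `f : ℝ → ℝ` with `f (φ + 1) = f φ + 1`, which
induce the same map on the circle of directions `ℝ / 2ℤ`. -/
structure GL2Cover where
  /-- the linear map -/
  T : ℂ ≃ₗ[ℝ] ℂ
  /-- the map on phases -/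
  f : ℝ → ℝ
  det_pos : 0 < LinearMap.det (T : ℂ →ₗ[ℝ] ℂ)
  strictMono : StrictMono f
  map_add_one (φ : ℝ) : f (φ + 1) = f φ + 1
  compat (φ : ℝ) : ∃ r : ℝ, 0 < r ∧
    T (Complex.exp (Real.pi * φ * Complex.I)) = r * Complex.exp (Real.pi * f φ * Complex.I)

section Serre

variable {k : Type w} [Field k] {C : Type u} [Category.{v} C] [Preadditive C] [Linear k C]
  [HasZeroObject C] [HasShift C ℤ] [∀ n : ℤ, (shiftFunctor C n).Additive] [Pretriangulated C]

/-- The maximal phase `φ⁺(X)` of the factors of the Harder-Narasimhan filtration of `X`,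
as an extended real number; it is `-∞` for a zero object. -/
def StabilityCondition.phiPlus (σ : StabilityCondition C) (X : C) : EReal :=
  sSup {x : EReal | ∃ L : List ℝ, HasHNPhases σ.P X L ∧ ∃ ψ ∈ L, x = (ψ : EReal)}

/-- `S · σ = σ · g` for some `g = (T, f)` in the universal cover of `GL₂⁺(ℝ)`. The slicing and the
central charge are `φ ↦ S (P φ)` and `Z ∘ S⁻¹` for `S · σ`, and `φ ↦ P (f φ)` and `T⁻¹ ∘ Z` for
`σ · g`; the two central charges are compared at the objects `S X`. -/
def StabilityCondition.IsSerreInvariant (σ : StabilityCondition C) (S : SerreFunctor k C) : Prop :=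
  ∃ g : GL2Cover, (∀ φ : ℝ, (σ.P φ).map S.functor = σ.P (g.f φ)) ∧
    ∀ X : C, σ.Z (K0.cls X) = g.T.symm (σ.Z (K0.cls (S.functor.obj X)))

/-- The upper Serre dimension `limsup_m φ⁺(S^m G) / m`, where `G` is a classical generator. -/
def upperSerreDim (S : SerreFunctor k C) (σ : StabilityCondition C) (G : C) : EReal :=
  Filter.limsup (fun m : ℕ => σ.phiPlus (S.functor.obj^[m] G) / (m : EReal)) Filter.atTop

end Serre

end SerreStab

end

namespace SerreStab

section Orthogonality

variable {C : Type u} [Category.{v} C] [Preadditive C]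

/-- The objects without nonzero morphisms to the objects of `P φ`, `φ ∈ I`. -/
def leftOrth (P : ℝ → ObjectProperty C) (I : Set ℝ) : ObjectProperty C := fun X =>
  ∀ φ ∈ I, ∀ Y, P φ Y → ∀ f : X ⟶ Y, f = 0

/-- The objects without nonzero morphisms from the objects of `P φ`, `φ ∈ I`. -/
def rightOrth (P : ℝ → ObjectProperty C) (I : Set ℝ) : ObjectProperty C := fun X =>
  ∀ φ ∈ I, ∀ Y, P φ Y → ∀ f : Y ⟶ X, f = 0

variable {P : ℝ → ObjectProperty C} {I J : Set ℝ}

lemma leftOrth.mono (h : J ⊆ I) {X : C} (hX : leftOrth P I X) : leftOrth P J X :=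
  fun φ hφ => hX φ (h hφ)

lemma rightOrth.mono (h : J ⊆ I) {X : C} (hX : rightOrth P I X) : rightOrth P J X :=
  fun φ hφ => hX φ (h hφ)

lemma leftOrth_of_isZero {X : C} (hX : IsZero X) : leftOrth P I X :=
  fun _ _ _ _ f => hX.eq_of_src f 0

lemma rightOrth_of_isZero {X : C} (hX : IsZero X) : rightOrth P I X :=
  fun _ _ _ _ f => hX.eq_of_tgt f 0

instance : (leftOrth P I).IsClosedUnderIsomorphisms where
  of_iso e hX φ hφ Y hY f := by
    rw [← cancel_epi e.hom, hX φ hφ Y hY (e.hom ≫ f), comp_zero]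

instance : (rightOrth P I).IsClosedUnderIsomorphisms where
  of_iso e hX φ hφ Y hY f := by
    rw [← cancel_mono e.inv, hX φ hφ Y hY (f ≫ e.inv), zero_comp]

section Equivalence

variable (F : C ⥤ C) [F.IsEquivalence] {e : ℝ → ℝ} (he : Function.Surjective e)
  (hF : ∀ φ X, P (e φ) (F.obj X) ↔ P φ X) (hP : ∀ φ, (P φ).IsClosedUnderIsomorphisms)

include he hF hP

lemma leftOrth_obj_iff (X : C) : leftOrth P I (F.obj X) ↔ leftOrth P (e ⁻¹' I) X := by
  constructor
  · intro h φ hφ Y hY f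
    exact (F.map_eq_zero_iff).1 (h (e φ) hφ _ ((hF φ Y).2 hY) (F.map f))
  · intro h ψ hψ Y hY f
    obtain ⟨φ, rfl⟩ := he ψ
    have hY' := (P (e φ)).prop_of_iso (F.objObjPreimageIso Y).symm hY
    have h0 := h φ hψ _ ((hF _ _).1 hY') (F.preimage (f ≫ (F.objObjPreimageIso Y).inv))
    rw [← F.map_eq_zero_iff, F.map_preimage] at h0
    simpa using h0

lemma rightOrth_obj_iff (X : C) : rightOrth P I (F.obj X) ↔ rightOrth P (e ⁻¹' I) X := by
  constructor
  · intro h φ hφ Y hY f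
    exact (F.map_eq_zero_iff).1 (h (e φ) hφ _ ((hF φ Y).2 hY) (F.map f))
  · intro h ψ hψ Y hY f
    obtain ⟨φ, rfl⟩ := he ψ
    have hY' := (P (e φ)).prop_of_iso (F.objObjPreimageIso Y).symm hY
    have h0 := h φ hψ _ ((hF _ _).1 hY') (F.preimage ((F.objObjPreimageIso Y).hom ≫ f))
    rw [← F.map_eq_zero_iff, F.map_preimage] at h0
    simpa using h0

end Equivalence

variable [HasZeroObject C] [HasShift C ℤ]
  [∀ n : ℤ, (shiftFunctor C n).Additive] [Pretriangulated C]

lemma leftOrth.ext₂ {X Y Z : C} {f : X ⟶ Y} {g : Y ⟶ Z} {h : Z ⟶ X⟦(1 : ℤ)⟧}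
    (hT : Triangle.mk f g h ∈ distTriang C) (hX : leftOrth P I X) (hZ : leftOrth P I Z) :
    leftOrth P I Y := fun φ hφ W hW a => by
  obtain ⟨b, hb⟩ := Triangle.yoneda_exact₂ _ hT a (hX φ hφ W hW _)
  rw [hb, hZ φ hφ W hW b]
  exact comp_zero

lemma rightOrth.ext₂ {X Y Z : C} {f : X ⟶ Y} {g : Y ⟶ Z} {h : Z ⟶ X⟦(1 : ℤ)⟧}
    (hT : Triangle.mk f g h ∈ distTriang C) (hX : rightOrth P I X) (hZ : rightOrth P I Z) :
    rightOrth P I Y := fun φ hφ W hW a => by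
  obtain ⟨b, hb⟩ := Triangle.coyoneda_exact₂ _ hT a (hZ φ hφ W hW _)
  rw [hb, hX φ hφ W hW b]
  exact zero_comp

lemma phaseInterval.hom_eq_zero {X Y : C} (hX : phaseInterval P I X) (hY : rightOrth P I Y)
    (f : X ⟶ Y) : f = 0 := by
  induction hX with
  | zero X hX => exact hX.eq_of_src _ _
  | of_mem X φ hφ hX => exact hY φ hφ X hX f
  | ext a b c hT _ _ ihX ihZ =>
    obtain ⟨d, hd⟩ := Triangle.yoneda_exact₂ _ hT f (ihX _)
    rw [hd, ihZ d]
    exact comp_zero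

lemma HasHNPhases.phaseInterval {X : C} {L : List ℝ} (hX : HasHNPhases P X L)
    (hL : ∀ ψ ∈ L, ψ ∈ I) : phaseInterval P I X := by
  induction hX with
  | zero X hX => exact .zero X hX
  | step f g h hT L _ ψ hA _ _ ih =>
    exact .ext f g h hT (ih fun φ hφ => hL φ (List.mem_cons_of_mem _ hφ))
      (.of_mem _ ψ (hL ψ List.mem_cons_self) hA)

end Orthogonality

namespace StabilityCondition

open ZeroObject

variable {C : Type u} [Category.{v} C] [Preadditive C] [HasZeroObject C] [HasShift C ℤ]
  [∀ n : ℤ, (shiftFunctor C n).Additive] [Pretriangulated C] (σ : StabilityCondition C)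

instance isClosedUnderIsomorphisms_P (φ : ℝ) : (σ.P φ).IsClosedUnderIsomorphisms where
  of_iso e hX := σ.of_iso φ e hX

lemma P_shift_iff (n : ℤ) (φ : ℝ) (X : C) : σ.P (φ + n) (X⟦n⟧) ↔ σ.P φ X := by
  induction n with
  | zero =>
    simpa using (σ.P φ).prop_iff_of_iso ((shiftFunctorZero C ℤ).app X)
  | succ n ih =>
    rw [← ih, ← σ.shift_iff (φ + (n : ℤ)),
      (σ.P _).prop_iff_of_iso ((shiftFunctorAdd C (n : ℤ) 1).app X)]
    simp [add_assoc]
  | pred n ih =>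
    rw [← ih, ← σ.shift_iff (φ + ((-n - 1 : ℤ) : ℝ)),
      (σ.P _).prop_iff_of_iso ((shiftFunctorAdd' C (-n - 1 : ℤ) 1 (-n) (by lia)).app X)]
    have : φ + ((-n - 1 : ℤ) : ℝ) + 1 = φ + ((-n : ℤ) : ℝ) := by push_cast; ring
    rw [this]
    rfl

lemma leftOrth_shift_iff (n : ℤ) {I : Set ℝ} (X : C) :
    leftOrth σ.P I (X⟦n⟧) ↔ leftOrth σ.P ((· + (n : ℝ)) ⁻¹' I) X :=
  leftOrth_obj_iff (shiftFunctor C n) (fun x => ⟨x - n, by simp⟩)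
    (σ.P_shift_iff n) (fun _ => inferInstance) X

lemma rightOrth_shift_iff (n : ℤ) {I : Set ℝ} (X : C) :
    rightOrth σ.P I (X⟦n⟧) ↔ rightOrth σ.P ((· + (n : ℝ)) ⁻¹' I) X :=
  rightOrth_obj_iff (shiftFunctor C n) (fun x => ⟨x - n, by simp⟩)
    (σ.P_shift_iff n) (fun _ => inferInstance) X

lemma leftOrth_of_phaseInterval {I J : Set ℝ} (h : ∀ φ ∈ I, ∀ ψ ∈ J, ψ < φ) {X : C}
    (hX : phaseInterval σ.P I X) : leftOrth σ.P J X := fun ψ hψ _ hY f =>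
  hX.hom_eq_zero (fun φ hφ _ hA g => σ.hom_eq_zero (h φ hφ ψ hψ) hA hY g) f

lemma rightOrth_of_phaseInterval {I J : Set ℝ} (h : ∀ φ ∈ I, ∀ ψ ∈ J, φ < ψ) {X : C}
    (hX : phaseInterval σ.P I X) : rightOrth σ.P J X := by
  induction hX with
  | zero X hX => exact rightOrth_of_isZero hX
  | of_mem X φ hφ hX => exact fun ψ hψ A hA f => σ.hom_eq_zero (h φ hφ ψ hψ) hA hX f
  | ext a b c hT _ _ ihX ihZ => exact ihX.ext₂ hT ihZ

lemma not_leftOrth_of_hasHNPhases {X : C} {ψ : ℝ} {L : List ℝ}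
    (hX : HasHNPhases σ.P X (ψ :: L)) : ¬ leftOrth σ.P {ψ} X := by
  rcases hX with _ | ⟨f, g, h, hT, _, hE, _, hA, hA0, hψ⟩
  rename_i E A
  intro h0
  have hg : g = 0 := h0 ψ rfl A hA g
  obtain ⟨r, hr⟩ := Triangle.yoneda_exact₃ _ hT (𝟙 A)
    ((Category.comp_id _).trans hg)
  have hE1 : leftOrth σ.P {ψ} (E⟦(1 : ℤ)⟧) := by
    rw [leftOrth_shift_iff]
    refine σ.leftOrth_of_phaseInterval (I := Set.Ioi ψ) ?_ (hE.phaseInterval hψ)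
    simp only [Set.mem_Ioi, Set.mem_preimage, Set.mem_singleton_iff]
    intro φ hφ χ hχ
    push_cast at hχ
    linarith
  refine hA0 ((IsZero.iff_id_eq_zero A).2 (hr.trans ?_))
  rw [hE1 ψ rfl A hA r]
  exact comp_zero

/-- The largest phase of a Harder-Narasimhan filtration of `X` is the largest `ψ` for which there
is a nonzero morphism from an object of `P ψ` to `X`. -/
lemma exists_isGreatest_of_hasHNPhases {X : C} {L : List ℝ} (hX : HasHNPhases σ.P X L)
    (hL : L ≠ []) :
    ∃ p, IsGreatest {ψ | ψ ∈ L} p ∧ IsGreatest {ψ | ¬ rightOrth σ.P {ψ} X} p := by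
  suffices ∃ p, IsGreatest {ψ | ψ ∈ L} p ∧ ¬ rightOrth σ.P {p} X by
    obtain ⟨p, hp, hp'⟩ := this
    refine ⟨p, hp, hp', fun ψ hψ => ?_⟩
    by_contra! hlt
    refine hψ (σ.rightOrth_of_phaseInterval (I := Set.Iic p) ?_ (hX.phaseInterval hp.2))
    rintro φ hφ _ rfl
    exact lt_of_le_of_lt hφ hlt
  induction hX with
  | zero => exact (hL rfl).elim
  | @step E X A f g h hT L hE ψ hA hA0 hψ ih =>
    by_cases hL' : L = []
    · subst hL'
      have hE0 : IsZero E := by cases hE; assumption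
      have : IsIso g := (Triangle.isZero₁_iff_isIso₂ _ hT).1 hE0
      refine ⟨ψ, by simp [IsGreatest, upperBounds], fun h0 => hA0 ?_⟩
      rw [IsZero.iff_id_eq_zero, ← IsIso.inv_hom_id g, h0 ψ rfl A hA (inv g), zero_comp]
    · obtain ⟨p, hp, hp'⟩ := ih hL'
      refine ⟨p, ⟨List.mem_cons_of_mem _ hp.1, ?_⟩, fun h0 => hp' ?_⟩
      · rintro φ hφ
        rcases List.mem_cons.1 hφ with rfl | hφ
        · exact (hψ p hp.1).le
        · exact hp.2 hφ
      · intro φ hφ B hB a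
        obtain rfl := Set.mem_singleton_iff.1 hφ
        obtain ⟨b, hb⟩ := Triangle.coyoneda_exact₂ _ (inv_rot_of_distTriang _ hT) a
          (h0 _ rfl B hB _)
        have hA1 : σ.P (ψ + (-1 : ℤ)) (A⟦(-1 : ℤ)⟧) := (σ.P_shift_iff _ _ _).2 hA
        have := hψ _ hp.1
        rw [hb, σ.hom_eq_zero (by push_cast; linarith) hB hA1 b]
        exact zero_comp

lemma le_phases_of_leftOrth {X : C} {L : List ℝ} (hX : HasHNPhases σ.P X L) {a : ℝ}
    (h : leftOrth σ.P (Set.Iio a) X) : ∀ ψ ∈ L, a ≤ ψ := by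
  rcases L with _ | ⟨φ, L⟩
  · simp
  · have h1 : a ≤ φ := by
      by_contra! hlt
      exact σ.not_leftOrth_of_hasHNPhases hX (h.mono (by simpa using hlt))
    intro ψ hψ
    rcases List.mem_cons.1 hψ with rfl | hψ
    · exact h1
    · cases hX
      rename_i h2
      exact h1.trans (h2 ψ hψ).le

lemma phases_lt_of_rightOrth {X : C} {L : List ℝ} (hX : HasHNPhases σ.P X L) {b : ℝ}
    (h : rightOrth σ.P (Set.Ici b) X) : ∀ ψ ∈ L, ψ < b := by
  intro ψ hψ
  obtain ⟨p, hp, hp'⟩ := σ.exists_isGreatest_of_hasHNPhases hX (List.ne_nil_of_mem hψ)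
  by_contra! hle
  exact hp'.1 (h.mono (by simpa using hle.trans (hp.2 hψ)))

lemma phaseInterval_Ico_eq (a b : ℝ) : phaseInterval σ.P (Set.Ico a b) =
    leftOrth σ.P (Set.Iio a) ⊓ rightOrth σ.P (Set.Ici b) := by
  ext X
  constructor
  · exact fun h => ⟨σ.leftOrth_of_phaseInterval (fun φ hφ ψ hψ => lt_of_lt_of_le hψ hφ.1) h,
      σ.rightOrth_of_phaseInterval (fun φ hφ ψ hψ => lt_of_lt_of_le hφ.2 hψ) h⟩
  · rintro ⟨h1, h2⟩
    obtain ⟨L, hL⟩ := σ.exists_HN X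
    exact hL.phaseInterval fun ψ hψ =>
      ⟨σ.le_phases_of_leftOrth hL h1 ψ hψ, σ.phases_lt_of_rightOrth hL h2 ψ hψ⟩

instance isClosedUnderIsomorphisms_phaseInterval (a b : ℝ) :
    (phaseInterval σ.P (Set.Ico a b)).IsClosedUnderIsomorphisms := by
  rw [phaseInterval_Ico_eq]
  infer_instance

lemma phaseInterval_Ico_obj_iff (F : C ⥤ C) [F.IsEquivalence] (e : ℝ ≃o ℝ)
    (hF : ∀ φ X, σ.P (e φ) (F.obj X) ↔ σ.P φ X) (a b : ℝ) (X : C) :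
    phaseInterval σ.P (Set.Ico (e a) (e b)) (F.obj X) ↔ phaseInterval σ.P (Set.Ico a b) X := by
  simp only [phaseInterval_Ico_eq]
  refine and_congr ?_ ?_
  · rw [leftOrth_obj_iff F e.surjective hF fun _ => inferInstance]
    simp
  · rw [rightOrth_obj_iff F e.surjective hF fun _ => inferInstance]
    simp

lemma map_phaseInterval_Ico (F : C ⥤ C) [F.IsEquivalence] (e : ℝ ≃o ℝ)
    (hF : ∀ φ X, σ.P (e φ) (F.obj X) ↔ σ.P φ X) (a b : ℝ) :
    (phaseInterval σ.P (Set.Ico a b)).map F = phaseInterval σ.P (Set.Ico (e a) (e b)) := by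
  ext Y
  constructor
  · rintro ⟨X, hX, ⟨i⟩⟩
    exact ObjectProperty.prop_of_iso _ i ((σ.phaseInterval_Ico_obj_iff F e hF a b X).2 hX)
  · intro hY
    have hY' := ObjectProperty.prop_of_iso _ (F.objObjPreimageIso Y).symm hY
    exact ⟨_, (σ.phaseInterval_Ico_obj_iff F e hF a b _).1 hY', ⟨F.objObjPreimageIso Y⟩⟩

lemma map_shift_phaseInterval_Ico (n : ℤ) (a b : ℝ) :
    (phaseInterval σ.P (Set.Ico a b)).map (shiftFunctor C n) =
      phaseInterval σ.P (Set.Ico (a + n) (b + n)) :=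
  σ.map_phaseInterval_Ico (shiftFunctor C n) (OrderIso.addRight (n : ℝ)) (σ.P_shift_iff n) a b

section PhiPlus

lemma phiPlus_eq {X : C} {p : ℝ} (hp : IsGreatest {ψ | ¬ rightOrth σ.P {ψ} X} p) :
    σ.phiPlus X = p := by
  have key {L : List ℝ} (hL : HasHNPhases σ.P X L) (hL' : L ≠ []) : IsGreatest {ψ | ψ ∈ L} p := by
    obtain ⟨q, hq, hq'⟩ := σ.exists_isGreatest_of_hasHNPhases hL hL'
    rwa [hp.unique hq']
  refine IsGreatest.csSup_eq ⟨?_, ?_⟩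
  · obtain ⟨L, hL⟩ := σ.exists_HN X
    refine ⟨L, hL, p, (key hL ?_).1, rfl⟩
    rintro rfl
    cases hL
    exact hp.1 (rightOrth_of_isZero (by assumption))
  · rintro _ ⟨L, hL, ψ, hψ, rfl⟩
    exact EReal.coe_le_coe_iff.2 ((key hL (List.ne_nil_of_mem hψ)).2 hψ)

lemma phiPlus_of_isZero {X : C} (hX : IsZero X) : σ.phiPlus X = ⊥ := by
  refine sSup_eq_bot.2 ?_
  rintro _ ⟨L, hL, ψ, hψ, rfl⟩
  rcases L with _ | ⟨φ, L⟩
  · simp at hψ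
  · exact (σ.not_leftOrth_of_hasHNPhases hL (leftOrth_of_isZero hX)).elim

lemma exists_isGreatest_of_not_isZero {X : C} (hX : ¬ IsZero X) :
    ∃ p, IsGreatest {ψ | ¬ rightOrth σ.P {ψ} X} p := by
  obtain ⟨L, hL⟩ := σ.exists_HN X
  obtain ⟨p, -, hp⟩ := σ.exists_isGreatest_of_hasHNPhases hL (by
    rintro rfl
    cases hL
    exact hX (by assumption))
  exact ⟨p, hp⟩

lemma isGreatest_obj (F : C ⥤ C) [F.IsEquivalence] (e : ℝ ≃o ℝ)
    (hF : ∀ φ X, σ.P (e φ) (F.obj X) ↔ σ.P φ X) {X : C} {p : ℝ}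
    (hp : IsGreatest {ψ | ¬ rightOrth σ.P {ψ} X} p) :
    IsGreatest {ψ | ¬ rightOrth σ.P {ψ} (F.obj X)} (e p) := by
  have key (φ : ℝ) : rightOrth σ.P {e φ} (F.obj X) ↔ rightOrth σ.P {φ} X := by
    rw [rightOrth_obj_iff F e.surjective hF fun _ => inferInstance]
    have : e ⁻¹' {e φ} = {φ} := by ext; simp
    rw [this]
  refine ⟨fun h => hp.1 ((key p).1 h), fun ψ hψ => ?_⟩
  obtain ⟨φ, rfl⟩ := e.surjective ψ
  exact e.monotone (hp.2 fun h => hψ ((key φ).2 h))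

end PhiPlus

section TStructure

lemma exists_truncation [IsTriangulated C] (a : ℝ) {X : C} {L : List ℝ}
    (hX : HasHNPhases σ.P X L) :
    ∃ (A B : C) (_ : leftOrth σ.P (Set.Iio a) A) (_ : rightOrth σ.P (Set.Ici a) B)
      (f : A ⟶ X) (g : X ⟶ B) (h : B ⟶ A⟦(1 : ℤ)⟧), Triangle.mk f g h ∈ distTriang C := by
  induction hX with
  | zero X hX =>
    exact ⟨X, 0, leftOrth_of_isZero hX, rightOrth_of_isZero (isZero_zero C), _, _, _,
      contractible_distinguished X⟩
  | @step E X A f g h hT L hE ψ hA hA0 hψ ih =>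
    by_cases haψ : a ≤ ψ
    · refine ⟨X, 0, ?_, rightOrth_of_isZero (isZero_zero C), _, _, _,
        contractible_distinguished X⟩
      refine leftOrth.ext₂ hT
        (σ.leftOrth_of_phaseInterval (I := Set.Ioi ψ) ?_ (hE.phaseInterval hψ))
        (fun φ hφ Y hY u => σ.hom_eq_zero (lt_of_lt_of_le hφ haψ) hA hY u)
      exact fun φ hφ χ hχ => (lt_of_lt_of_le hχ haψ).trans hφ
    · obtain ⟨A', B', hA', hB', u, v, w, hT'⟩ := ih
      obtain ⟨Z, v', w', hZ⟩ := distinguished_cocone_triangle (u ≫ f)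
      have o := Triangulated.someOctahedron rfl hT' hT hZ
      refine ⟨A', Z, hA', hB'.ext₂ o.mem ?_, _, _, _, hZ⟩
      exact fun φ hφ Y hY u => σ.hom_eq_zero (lt_of_lt_of_le (not_le.1 haψ) hφ) hY hA u

variable [IsTriangulated C]

/-- The bounded t-structure with heart `P([φ, φ + 1))`. -/
def tStructure (φ : ℝ) : Triangulated.TStructure C where
  le n := leftOrth σ.P (Set.Iio (φ - n))
  ge n := rightOrth σ.P (Set.Ici (φ + 1 - n))
  le_shift n a n' h X hX := by
    refine (σ.leftOrth_shift_iff a X).2 (hX.mono fun ψ hψ => ?_)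
    subst h
    simp only [Set.mem_preimage, Set.mem_Iio, Int.cast_add] at hψ ⊢
    linarith
  ge_shift n a n' h X hX := by
    refine (σ.rightOrth_shift_iff a X).2 (hX.mono fun ψ hψ => ?_)
    subst h
    simp only [Set.mem_preimage, Set.mem_Ici, Int.cast_add] at hψ ⊢
    linarith
  zero' X Y f hX hY := by
    obtain ⟨L, hL⟩ := σ.exists_HN X
    refine (hL.phaseInterval (I := Set.Ici (φ - (0 : ℤ)))
      (σ.le_phases_of_leftOrth hL hX)).hom_eq_zero (hY.mono fun ψ hψ => ?_) f
    simpa using hψ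
  le_zero_le X hX := hX.mono fun ψ hψ => by
    simp only [Set.mem_Iio, Int.cast_one, Int.cast_zero] at hψ ⊢
    linarith
  ge_one_le X hX := hX.mono fun ψ hψ => by
    simp only [Set.mem_Ici, Int.cast_one, Int.cast_zero] at hψ ⊢
    linarith
  exists_triangle_zero_one X := by
    obtain ⟨L, hL⟩ := σ.exists_HN X
    simpa using σ.exists_truncation φ hL

lemma tStructure_heart (φ : ℝ) :
    (σ.tStructure φ).heart = phaseInterval σ.P (Set.Ico φ (φ + 1)) := by
  rw [phaseInterval_Ico_eq]
  simp [Triangulated.TStructure.heart, tStructure]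

lemma tStructure_bounded (φ : ℝ) : (σ.tStructure φ).bounded = ⊤ := by
  refine top_le_iff.1 fun X _ => ?_
  obtain ⟨L, hL⟩ := σ.exists_HN X
  obtain ⟨a, ha⟩ := L.toFinset.finite_toSet.bddBelow
  obtain ⟨b, hb⟩ := L.toFinset.finite_toSet.bddAbove
  have hI := hL.phaseInterval (I := Set.Icc a b) fun ψ hψ => ⟨ha (by simpa), hb (by simpa)⟩
  obtain ⟨m, hm⟩ := exists_int_lt (φ + 1 - b)
  obtain ⟨n, hn⟩ := exists_int_gt (φ - a)
  refine ⟨⟨m, ⟨σ.rightOrth_of_phaseInterval (fun ψ hψ χ hχ => ?_) hI⟩⟩,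
    ⟨n, ⟨σ.leftOrth_of_phaseInterval (fun ψ hψ χ hχ => ?_) hI⟩⟩⟩
  · linarith [hψ.2, Set.mem_Ici.1 hχ]
  · linarith [hψ.1, Set.mem_Iio.1 hχ]

end TStructure

end StabilityCondition

namespace GL2Cover

/-- The action on phases, as a lift of a homeomorphism of the circle. -/
def circleDeg1Lift (g : GL2Cover) : CircleDeg1Lift :=
  ⟨⟨g.f, g.strictMono.monotone⟩, g.map_add_one⟩

lemma surjective (g : GL2Cover) : Function.Surjective g.f := by
  have hint (m : ℤ) (x : ℝ) : g.f (x + m) = g.f x + m := g.circleDeg1Lift.map_add_int x m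
  intro ψ
  set w := g.T.symm (Complex.exp (Real.pi * ψ * Complex.I)) with hw
  have hw0 : w ≠ 0 := by simp [hw]
  obtain ⟨r, hr, hr'⟩ := g.compat (w.arg / Real.pi)
  have hpi : (Real.pi : ℂ) ≠ 0 := by exact_mod_cast Real.pi_ne_zero
  have harg : (Real.pi * ((w.arg / Real.pi : ℝ) : ℂ) * Complex.I) = w.arg * Complex.I := by
    push_cast
    field_simp
  have hTw : g.T w = ((‖w‖ * r : ℝ) : ℂ) *
      Complex.exp ((Real.pi * g.f (w.arg / Real.pi) : ℝ) * Complex.I) := by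
    conv_lhs => rw [← Complex.norm_mul_exp_arg_mul_I w]
    rw [← Complex.real_smul, map_smul, ← harg, hr', Complex.real_smul]
    push_cast
    ring
  have hn : 0 < ‖w‖ * r := mul_pos (norm_pos_iff.2 hw0) hr
  rw [hw, LinearEquiv.apply_symm_apply, ← hw] at hTw
  have h1 : ‖w‖ * r = 1 := by
    have := congrArg norm hTw
    rw [norm_mul, Complex.norm_exp_ofReal_mul_I, Complex.norm_real, Real.norm_of_nonneg hn.le,
      ← Complex.ofReal_mul, Complex.norm_exp_ofReal_mul_I] at this
    linarith
  rw [h1, Complex.ofReal_one, one_mul, Complex.exp_eq_exp_iff_exists_int] at hTw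
  obtain ⟨m, hm⟩ := hTw
  refine ⟨w.arg / Real.pi + (2 * m : ℤ), ?_⟩
  rw [hint]
  have h2 : (Real.pi : ℂ) * Complex.I * (ψ : ℂ) = Real.pi * Complex.I *
      ((g.f (w.arg / Real.pi) + (2 * m : ℤ) : ℝ) : ℂ) := by
    push_cast at hm ⊢
    linear_combination hm
  exact_mod_cast (mul_left_cancel₀ (mul_ne_zero hpi Complex.I_ne_zero) h2).symm

/-- The action on phases, as an order automorphism of `ℝ`. -/
noncomputable def orderIso (g : GL2Cover) : ℝ ≃o ℝ := g.strictMono.orderIsoOfSurjective g.f g.surjective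

lemma exists_orderIso_eq_add (g : GL2Cover) {n : ℕ} (h : g.circleDeg1Lift.translationNumber = n) :
    ∃ φ, g.orderIso φ = φ + n := by
  rw [← h]
  exact g.circleDeg1Lift.exists_eq_add_translationNumber
    (g.circleDeg1Lift.continuous_iff_surjective.2 g.surjective)

end GL2Cover

section Serre

variable {k : Type w} [Field k] {C : Type u} [Category.{v} C] [Preadditive C] [Linear k C]

lemma SerreFunctor.hom_ne_zero (S : SerreFunctor k C) {X : C} (hX : ¬ IsZero X) :
    ∃ f : X ⟶ S.functor.obj X, f ≠ 0 := by
  by_contra! h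
  refine hX ((IsZero.iff_id_eq_zero X).2 ((S.duality X X).injective ?_))
  ext f
  rw [h f, map_zero, map_zero]

lemma SerreFunctor.hom_eq_zero (S : SerreFunctor k C) {X Y : C}
    (h : ∀ f : Y ⟶ S.functor.obj X, f = 0) (f : X ⟶ Y) : f = 0 := by
  apply (S.duality X Y).injective
  ext a
  rw [h a, map_zero, map_zero]

variable [HasZeroObject C] [HasShift C ℤ]
  [∀ n : ℤ, (shiftFunctor C n).Additive] [Pretriangulated C]

lemma upperSerreDim_of_isZero (S : SerreFunctor k C) (σ : StabilityCondition C) {G : C}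
    (hG : IsZero G) : upperSerreDim S σ G = ⊥ := by
  have := S.isEquivalence
  have hz (m : ℕ) : IsZero (S.functor.obj^[m] G) := by
    induction m with
    | zero => exact hG
    | succ m ih =>
      rw [Function.iterate_succ_apply']
      exact S.functor.map_isZero ih
  refine (Filter.limsup_congr (v := fun _ => ⊥) ?_).trans (Filter.limsup_const _)
  filter_upwards [Filter.eventually_gt_atTop 0] with m hm
  rw [σ.phiPlus_of_isZero (hz m)]
  exact EReal.bot_div_of_pos_ne_top (by exact_mod_cast hm) (EReal.natCast_ne_top m)

lemma upperSerreDim_eq_translationNumber (S : SerreFunctor k C) (σ : StabilityCondition C)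
    (g : GL2Cover) (hg : ∀ φ X, σ.P (g.orderIso φ) (S.functor.obj X) ↔ σ.P φ X) {G : C}
    (hG : ¬ IsZero G) :
    upperSerreDim S σ G = ((g.circleDeg1Lift.translationNumber : ℝ) : EReal) := by
  have := S.isEquivalence
  obtain ⟨p, hp⟩ := σ.exists_isGreatest_of_not_isZero hG
  have hm (m : ℕ) : IsGreatest {ψ | ¬ rightOrth σ.P {ψ} (S.functor.obj^[m] G)}
      ((g.circleDeg1Lift ^ m) p) := by
    induction m with
    | zero => exact hp
    | succ m ih =>
      rw [Function.iterate_succ_apply', pow_succ', CircleDeg1Lift.mul_apply]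
      exact σ.isGreatest_obj S.functor g.orderIso hg ih
  have hlim := g.circleDeg1Lift.tendsto_translationNumber p
  have hlim' : Filter.Tendsto (fun m : ℕ => (g.circleDeg1Lift ^ m) p / m) Filter.atTop
      (nhds g.circleDeg1Lift.translationNumber) := by
    have h0 := tendsto_const_div_atTop_nhds_zero_nat p
    simpa [sub_div] using hlim.add h0
  have := (continuous_coe_real_ereal.tendsto _).comp hlim'
  rw [← this.limsup_eq]
  refine Filter.limsup_congr (Filter.Eventually.of_forall fun m => ?_)
  rw [σ.phiPlus_eq (hm m)]
  rfl

/-- If `S A[-n] = A` for `A = P([φ, φ + 1))`, then `A` has homological dimension `n`. -/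
lemma hasHomologicalDimension_of_map_eq (S : SerreFunctor k C) (σ : StabilityCondition C)
    {φ : ℝ} {n : ℤ} (hS : (phaseInterval σ.P (Set.Ico φ (φ + 1))).map S.functor =
      phaseInterval σ.P (Set.Ico (φ + n) (φ + 1 + n))) {G : C} (hG : ¬ IsZero G) :
    HasHomologicalDimension (phaseInterval σ.P (Set.Ico φ (φ + 1))) n := by
  have hobj {X : C} (hX : phaseInterval σ.P (Set.Ico φ (φ + 1)) X) :
      phaseInterval σ.P (Set.Ico (φ + n) (φ + 1 + n)) (S.functor.obj X) :=
    hS ▸ ObjectProperty.prop_map_obj _ _ hX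
  constructor
  · obtain ⟨A, hA, hA0⟩ : ∃ A, phaseInterval σ.P (Set.Ico φ (φ + 1)) A ∧ ¬ IsZero A := by
      obtain ⟨L, hL⟩ := σ.exists_HN G
      cases hL with
      | zero _ h => exact (hG h).elim
      | step f g h hT L hE ψ hA hA0 hψ =>
        rename_i E A
        refine ⟨A⟦-⌊ψ - φ⌋⟧, .of_mem _ (ψ + ((-⌊ψ - φ⌋ : ℤ) : ℝ)) ?_
          ((σ.P_shift_iff _ _ _).2 hA), fun h0 => hA0 ?_⟩
        · have h1 := Int.floor_le (ψ - φ)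
          have h2 := Int.lt_floor_add_one (ψ - φ)
          push_cast
          constructor <;> linarith
        · rw [IsZero.iff_id_eq_zero] at h0 ⊢
          rw [← (shiftFunctor C (-⌊ψ - φ⌋)).map_eq_zero_iff, CategoryTheory.Functor.map_id, h0]
    obtain ⟨f, hf⟩ := S.hom_ne_zero hA0
    have hSA := hobj hA
    rw [← σ.map_shift_phaseInterval_Ico] at hSA
    obtain ⟨B, hB, ⟨e⟩⟩ := hSA
    refine ⟨A, B, hA, hB, f ≫ e.inv, fun h0 => hf ?_⟩
    rw [← cancel_mono e.inv, h0, zero_comp]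
  · rintro i ⟨X, Y, hX, hY, f, hf⟩
    by_contra! hlt
    refine hf (S.hom_eq_zero (fun a => ?_) f)
    have hYi : phaseInterval σ.P (Set.Ico (φ + i) (φ + 1 + i)) (Y⟦i⟧) :=
      σ.map_shift_phaseInterval_Ico i _ _ ▸ ObjectProperty.prop_map_obj _ _ hY
    refine hYi.hom_eq_zero (σ.rightOrth_of_phaseInterval (fun ψ hψ χ hχ => ?_) (hobj hX)) a
    have : (n : ℝ) + 1 ≤ i := by exact_mod_cast hlt
    linarith [hψ.2, hχ.1]

end Serre

end SerreStab

theorem mainTheorem7 (k : Type w) [Field k] (C : Type u) [Category.{v} C] [Preadditive C]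
    [Linear k C] [HasZeroObject C] [HasShift C ℤ] [∀ n : ℤ, (shiftFunctor C n).Additive]
    [∀ n : ℤ, (shiftFunctor C n).Linear k] [Pretriangulated C] [IsTriangulated C]
    (hfin : SerreStab.IsFiniteType k C) (S : SerreStab.SerreFunctor k C)
    (G : C) (hG : (ObjectProperty.singleton G).IsClassicalTriangulatedGenerator)
    (σ : SerreStab.StabilityCondition C) (hσ : σ.IsSerreInvariant S)
    (n : ℕ) (hn : 0 < n) (hdim : SerreStab.upperSerreDim S σ G = (n : EReal)) :
    ∃ φ : ℝ,
      (∃ t : Triangulated.TStructure C, t.bounded = ⊤ ∧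
        t.heart = SerreStab.phaseInterval σ.P (Set.Ico φ (φ + 1))) ∧
      ((SerreStab.phaseInterval σ.P (Set.Ico φ (φ + 1))).map S.functor).map
          (shiftFunctor C (-(n : ℤ))) =
        SerreStab.phaseInterval σ.P (Set.Ico φ (φ + 1)) ∧
      SerreStab.HasHomologicalDimension
        (SerreStab.phaseInterval σ.P (Set.Ico φ (φ + 1))) (n : ℤ) := by
  obtain ⟨g, hP, -⟩ := hσ
  have := S.isEquivalence
  have hg (φ : ℝ) (X : C) : σ.P (g.orderIso φ) (S.functor.obj X) ↔ σ.P φ X := by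
    change σ.P (g.f φ) _ ↔ _
    rw [← hP]
    exact ⟨fun ⟨Y, hY, ⟨e⟩⟩ => σ.of_iso φ (S.functor.preimageIso e) hY,
      fun hX => ObjectProperty.prop_map_obj _ _ hX⟩
  have hG0 : ¬ IsZero G := fun h0 => by
    rw [SerreStab.upperSerreDim_of_isZero S σ h0] at hdim
    exact EReal.natCast_ne_bot n hdim.symm
  rw [SerreStab.upperSerreDim_eq_translationNumber S σ g hg hG0] at hdim
  obtain ⟨φ, hφ⟩ := g.exists_orderIso_eq_add (n := n) (by exact_mod_cast hdim)
  have hS : (SerreStab.phaseInterval σ.P (Set.Ico φ (φ + 1))).map S.functor =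
      SerreStab.phaseInterval σ.P (Set.Ico (φ + (n : ℤ)) (φ + 1 + (n : ℤ))) := by
    rw [σ.map_phaseInterval_Ico S.functor g.orderIso hg]
    have h1 : g.orderIso (φ + 1) = g.orderIso φ + 1 := g.map_add_one φ
    rw [h1, hφ, add_right_comm, Int.cast_natCast]
  refine ⟨φ, ⟨σ.tStructure φ, σ.tStructure_bounded φ, σ.tStructure_heart φ⟩, ?_,
    SerreStab.hasHomologicalDimension_of_map_eq S σ hS hG0⟩
  rw [hS, σ.map_shift_phaseInterval_Ico]
  simp
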